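/- **Setting.** Let $N,d,D\ge 1$ and let $\Xi\subset\mathbb R^D$ contain two distinct points at distance at most $1$. For a set $\mathcal H$ of functions $\Xi\to\mathbb R^d$ and probability distributions $\mathcal D,\mathcal D'$ on $\Xi$, put $d_{\mathcal H}(\mathcal D,\mathcal D')=\sup_{h\in\mathcal H}\|\mathbb E_{\mathcal D}h-\mathbb E_{\mathcal D'}h\|$ (supremum over the $h\in\mathcal H$ that are integrable under both). Let $\mathcal H_{\rm Loc.Bounded}$ be the set of $h:\Xi\to\mathbb R^d$ such that $h(\mathcal B(\xi,1)\cap\Xi)$ has diameter at most $1$ for every $\xi\in\Xi$ (closed balls). A *problem* consists of probability distributions $\mathcal D_1,\dots,\mathcal D_N$ on $\Xi$, a measurable loss $\ell:\mathbb R^d\times\Xi\to\mathbb R$ with finite expectations $f_i(x)=\mathbb E_{\xi\sim\mathcal D_i}\ell(x,\xi)$, and a measurable $g:\mathbb R^d\times\Xi\to\mathbb R^d$ with $g(x,\xi)=\nabla_x\ell(x,\xi)$ wherever this gradient exists and $\mathbb E_{\mathcal D_i}g(x,\xi)\in\partial f_i(x)$ for all $i,x$. For $r,B,\sigma,\mu,L>0$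 and weights $b=(b_{ij})$: * $\tilde{\mathbb D}(r,b,B)$ is the set of problems such that every $f_i$ is convex and has a minimizer $x_i^\star$ over $\mathbb R^d$ with $\|x_i^\star\|\le r$, $\mathbb E_{\mathcal D_i}\|g(x,\xi)\|^2\le B^2$ for all $i,x$, and $d_{\mathcal H}(\mathcal D_i,\mathcal D_j)\le b_{ij}$ for all $i,j$; * $\tilde{\mathbb D}_\mu^L(r,b,\sigma)$ is the set of problems such that every $f_i$ is $\mu$-strongly convex and $L$-smooth with minimizer $\|x_i^\star\|\le r$, $\mathbb E_{\mathcal D_i}\|g(x,\xi)-\nabla f_i(x)\|^2\le\sigma^2$ for all $i,x$, and $d_{\mathcal H}(\mathcal D_i,\mathcal D_j)\le b_{ij}$ for all $i,j$. At each call, the oracle receives queries $(y_1,\dots,y_N)\in(\mathbb R^d)^N$ and returns $(j,y_j,\xi_j,\ell(y_j,\xi_j),g(y_j,\xi_j))$ with fresh independent $\xi_j\sim\mathcal D_j$, for all agents $j$ (*synchronous* oracle, $N$ samples per call) or for one uniformly random agent $j$ (*asynchronous* oracle, one sample per call). A method $\mathcal M=(\mathcal M_T)_T$ is a family of randomized adaptive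 procedures that do not depend on the problem: $\mathcal M_T$ makes $K$ oracle calls using $T$ samples in total ($T=NK$, respectively $T=K$) and returns $x_i^T\in\mathbb R^d$ for agent $i$. Let $\mathcal T_i^\varepsilon(\mathcal M,p)$ be the least attainable $T\ge1$ such that $\mathbb E[f_i(x_i^{T'})-\min f_i]\le\varepsilon$ for all attainable $T'\ge T$ on the problem $p$ ($+\infty$ if there is none). **Theorem.** There are universal constants $C,C'>0$ such that the following holds for all $N,d,D,\Xi$ as above, both oracles, every agent $i$, every $\varepsilon\in(0,1/16)$, every $r,B,\sigma>0$, every $b$ that is nonnegative and symmetric with $b_{jj}=0$ and $b_{jk}\le b_{jl}+b_{lk}$, and every $\mathcal H\subset\mathcal H_{\rm Loc.Bounded}$ (in particular, every $\mathcal H$ with $\mathcal H_{\rm Affine}\subset\mathcal H\subset\mathcal H_{\rm Loc.Bounded}$, where $\mathcal H_{\rm Affine}$ is the set of $1$-Lipschitz affine functions). Let $\mathcal N_i^\varepsilon(b/4)$ be the number of agents $j$ with $b_{ij}/4\le\varepsilon$. If $r^2B^2\ge1$, then $$\inf_{\mathcal M}\ \sup_{p\in\tilde{\mathbb D}(r,b,B)}\mathcal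 T_i^\varepsilon(\mathcal M,p)\ \ge\ \frac{C\,B^2r^2N}{\varepsilon^2\,\mathcal N_i^\varepsilon(b/4)},$$ and if $r^2\sigma^2\ge2$, then, with $\mu=L=1/r^2$, $$\inf_{\mathcal M}\ \sup_{p\in\tilde{\mathbb D}_{\mu}^{L}(r,b,\sigma)}\mathcal T_i^\varepsilon(\mathcal M,p)\ \ge\ \frac{C'\,r^2\sigma^2N}{\varepsilon\,\mathcal N_i^\varepsilon(b/4)}.$$ -/

import Mathlib

open MeasureTheory
open scoped ENNReal

noncomputable section

namespace CollabGEM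

/-- `ℝ^n` with its Euclidean norm. -/
abbrev Vec (n : ℕ) : Type := EuclideanSpace ℝ (Fin n)

/-! ### Distances between distributions -/

/-- The functions `h : Ξ → ℝ^d` such that `h (B(ξ, 1) ∩ Ξ)` has diameter at most `1` for every
`ξ ∈ Ξ` (balls are closed). `Ξ` is a subtype, so its closed balls are the traces of those
of the ambient space. -/
def locBounded {D : ℕ} (Ξ : Set (Vec D)) (d : ℕ) : Set (Ξ → Vec d) :=
  {h | ∀ ξ : Ξ, Metric.ediam (h '' Metric.closedBall ξ 1) ≤ 1}

/-- `d_H(P, Q) = sup_{h ∈ H} ‖E_P h - E_Q h‖`, the supremum being over the `h ∈ H` whose two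
expectations exist. -/
def distH {D d : ℕ} {Ξ : Set (Vec D)} (H : Set (Ξ → Vec d)) (P Q : Measure Ξ) : ℝ≥0∞ :=
  ⨆ h ∈ H, ⨆ (_ : Integrable h P) (_ : Integrable h Q), ‖∫ ξ, h ξ ∂P - ∫ ξ, h ξ ∂Q‖ₑ

/-! ### Problem instances -/

/-- `N` probability distributions on `Ξ`, a loss `ℓ : ℝ^d × Ξ → ℝ`, and the stochastic
(sub)gradient `g(x, ξ)` that the oracle returns: it is `∇_x ℓ(x, ξ)` wherever that gradient
exists, and its expectation under the `i`-th distribution is a subgradient of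
`f_i(x) = E[ℓ(x, ξ_i)]`. -/
structure Problem {D : ℕ} (N d : ℕ) (Ξ : Set (Vec D)) where
  dist : Fin N → Measure Ξ
  loss : Vec d → Ξ → ℝ
  grad : Vec d → Ξ → Vec d
  prob : ∀ i, IsProbabilityMeasure (dist i)
  measurable_loss : Measurable (Function.uncurry loss)
  measurable_grad : Measurable (Function.uncurry grad)
  integrable_loss : ∀ i x, Integrable (loss x) (dist i)
  integrable_grad : ∀ i x, Integrable (grad x) (dist i)
  grad_eq : ∀ x ξ, DifferentiableAt ℝ (fun y => loss y ξ) x →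
    grad x ξ = gradient (fun y => loss y ξ) x
  subgrad : ∀ i x y, (∫ ξ, loss x ξ ∂dist i) + inner ℝ (∫ ξ, grad x ξ ∂dist i) (y - x)
    ≤ ∫ ξ, loss y ξ ∂dist i

variable {D N d : ℕ} {Ξ : Set (Vec D)}

/-- The local objective `f_i(x) = E[ℓ(x, ξ_i)]`. -/
def Problem.obj (p : Problem N d Ξ) (i : Fin N) (x : Vec d) : ℝ :=
  ∫ ξ, p.loss x ξ ∂p.dist i

/-- Every `f_i` has a minimizer `x_i⋆` over `ℝ^d` with `‖x_i⋆‖ ≤ r`. -/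
def Problem.MinimizersIn (p : Problem N d Ξ) (r : ℝ) : Prop :=
  ∀ i, ∃ x, (∀ y, p.obj i x ≤ p.obj i y) ∧ ‖x‖ ≤ r

/-- The distribution-based bias assumption `d_H(D_i, D_j) ≤ b_ij`. -/
def Problem.DistBias (p : Problem N d Ξ) (H : Set (Ξ → Vec d)) (b : Fin N → Fin N → ℝ) : Prop :=
  ∀ i j, distH H (p.dist i) (p.dist j) ≤ ENNReal.ofReal (b i j)

/-- Every `f_i` is convex and `E‖g_i(x)‖² ≤ B²` for all `x`. -/
def Problem.ConvexNoise (p : Problem N d Ξ) (B : ℝ) : Prop :=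
  (∀ i, ConvexOn ℝ Set.univ (p.obj i)) ∧
  ∀ i x, ∫⁻ ξ, ‖p.grad x ξ‖ₑ ^ 2 ∂p.dist i ≤ ENNReal.ofReal (B ^ 2)

/-- Every `f_i` is `μ`-strongly convex and `L`-smooth, and `E‖g_i(x) - ∇f_i(x)‖² ≤ σ²`
for all `x`. -/
def Problem.SmoothNoise (p : Problem N d Ξ) (μ L σ : ℝ) : Prop :=
  (∀ i, StrongConvexOn Set.univ μ (p.obj i)) ∧
  (∀ i, Differentiable ℝ (p.obj i) ∧
    ∀ x y, ‖gradient (p.obj i) x - gradient (p.obj i) y‖ ≤ L * ‖x - y‖) ∧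
  ∀ i x, ∫⁻ ξ, ‖p.grad x ξ - gradient (p.obj i) x‖ₑ ^ 2 ∂p.dist i ≤ ENNReal.ofReal (σ ^ 2)

/-- The class of convex problems with distribution-based bias assumption. -/
def convexClass (N d : ℕ) (Ξ : Set (Vec D)) (H : Set (Ξ → Vec d)) (r : ℝ)
    (b : Fin N → Fin N → ℝ) (B : ℝ) : Set (Problem N d Ξ) :=
  {p | p.MinimizersIn r ∧ p.ConvexNoise B ∧ p.DistBias H b}

/-- The class of strongly convex and smooth problems with distribution-based bias assumption. -/
def smoothClass (N d : ℕ) (Ξ : Set (Vec D)) (H : Set (Ξ → Vec d)) (μ L r : ℝ)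
    (b : Fin N → Fin N → ℝ) (σ : ℝ) : Set (Problem N d Ξ) :=
  {p | p.MinimizersIn r ∧ p.SmoothNoise μ L σ ∧ p.DistBias H b}

/-! ### Oracles -/

/-- The synchronous oracle: at each call all agents sample. The asynchronous oracle: at each call
one uniformly random agent samples. -/
inductive Oracle
  | sync
  | async

/-- The number of samples drawn at each oracle call. -/
def Oracle.perCall : Oracle → ℕ → ℕ
  | .sync, N => N
  | .async, _ => 1

/-- The law of the pair (agent, data item) of the `s`-th sample of an oracle call: agent `s` and
an item of its distribution for the synchronous oracle, a uniformly random agent and an item of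
its distribution for the asynchronous one. -/
def Oracle.sampleLaw : (o : Oracle) → (Fin N → Measure Ξ) → Fin (o.perCall N) →
    Measure (Fin N × Ξ)
  | .sync, P, s => (P s).map (Prod.mk s)
  | .async, P, _ => ∑ j : Fin N, (N : ℝ≥0∞)⁻¹ • (P j).map (Prod.mk j)

/-- The samples drawn at one oracle call. -/
abbrev Draw (N : ℕ) (Ξ : Set (Vec D)) (o : Oracle) : Type :=
  Fin (o.perCall N) → Fin N × Ξ

/-- What the method sees of one oracle call: for each sample, the tuple
`(j, y_j, ξ_j, ℓ(y_j, ξ_j), g(y_j, ξ_j))`. -/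
abbrev Reply (N d : ℕ) (Ξ : Set (Vec D)) (o : Oracle) : Type :=
  Fin (o.perCall N) → Fin N × Vec d × Ξ × ℝ × Vec d

/-- The law of the samples of `K` oracle calls, all of which are independent. -/
def drawsLaw (o : Oracle) (P : Fin N → Measure Ξ) (K : ℕ) : Measure (Fin K → Draw N Ξ o) :=
  Measure.pi fun _ => Measure.pi (o.sampleLaw P)

/-- The reply of the oracle to the query `y = (y_1, …, y_N)`. -/
def Problem.reply (p : Problem N d Ξ) (o : Oracle) (y : Fin N → Vec d) (w : Draw N Ξ o) :
    Reply N d Ξ o :=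
  fun s => ((w s).1, y (w s).1, (w s).2, p.loss (y (w s).1) (w s).2, p.grad (y (w s).1) (w s).2)

/-! ### Methods and sample complexity -/

/-- A randomized method that makes `K` oracle calls: the query of each call is a measurable
function of a random seed and of the replies to the previous calls, and the point that is
returned is a measurable function of the seed and of all `K` replies. -/
structure Algorithm (N d : ℕ) (Ξ : Set (Vec D)) (o : Oracle) (K : ℕ) where
  Seed : Type
  measurableSpace : MeasurableSpace Seed
  seedLaw : Measure Seed
  prob : IsProbabilityMeasure seedLaw
  query : (k : ℕ) → Seed → (Fin k → Reply N d Ξ o) → Fin N → Vec d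
  output : Seed → (Fin K → Reply N d Ξ o) → Vec d
  measurable_query : ∀ k, Measurable (Function.uncurry (query k))
  measurable_output : Measurable (Function.uncurry output)

attribute [instance] Algorithm.measurableSpace Algorithm.prob

/-- The replies to the first `k` queries, as a function of the seed and of the samples. -/
def Algorithm.replies {o : Oracle} {K : ℕ} (A : Algorithm N d Ξ o K) (p : Problem N d Ξ)
    (ω : A.Seed) : (k : ℕ) → (Fin k → Draw N Ξ o) → (Fin k → Reply N d Ξ o)
  | 0, _ => Fin.elim0
  | k + 1, w =>
    Fin.snoc (α := fun _ => Reply N d Ξ o) (A.replies p ω k (Fin.init w))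
      (p.reply o (A.query k ω (A.replies p ω k (Fin.init w))) (w (Fin.last k)))

/-- The expected generalization error `E[f_i(x_i) - min f_i]` of the returned point `x_i`. -/
def Algorithm.error {o : Oracle} {K : ℕ} (A : Algorithm N d Ξ o K) (p : Problem N d Ξ)
    (i : Fin N) : ℝ≥0∞ :=
  ∫⁻ z, ENNReal.ofReal (p.obj i (A.output z.1 (A.replies p z.1 K z.2)) - ⨅ x, p.obj i x)
    ∂(A.seedLaw.prod (drawsLaw o p.dist K))

/-- A method: one algorithm for each number of oracle calls. It does not depend on the problem. -/
def Method (N d : ℕ) (Ξ : Set (Vec D)) (o : Oracle) : Type 1 :=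
  (K : ℕ) → Algorithm N d Ξ o K

/-- The number of samples, drawn from all agents in total, from which on the generalization error
of agent `i` is at most `ε` (`∞` if there is none). `K ≥ 1` oracle calls use
`K * o.perCall N` samples. -/
def Method.sampleComplexity {o : Oracle} (M : Method N d Ξ o) (p : Problem N d Ξ) (i : Fin N)
    (ε : ℝ) : ℝ≥0∞ :=
  ⨅ (K : ℕ) (_ : 1 ≤ K ∧ ∀ K', K ≤ K' → (M K').error p i ≤ ENNReal.ofReal ε),
    ((K * o.perCall N : ℕ) : ℝ≥0∞)

/-- The minimax sample complexity of agent `i` over a class of problems. -/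
def minimaxComplexity (o : Oracle) (C : Set (Problem N d Ξ)) (i : Fin N) (ε : ℝ) : ℝ≥0∞ :=
  ⨅ M : Method N d Ξ o, ⨆ p ∈ C, M.sampleComplexity p i ε

/-- `𝒩_i^ε(b)`, the number of agents `j` with `b_ij ≤ ε`. -/
def numClose (b : Fin N → Fin N → ℝ) (ε : ℝ) (i : Fin N) : ℕ :=
  (Finset.univ.filter fun j => b i j ≤ ε).card

/-- Nonnegative weights that vanish on the diagonal, are symmetric, and verify the triangle
inequality. -/
structure IsPseudoDist (b : Fin N → Fin N → ℝ) : Prop where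
  nonneg : ∀ i j, 0 ≤ b i j
  self : ∀ i, b i i = 0
  symm : ∀ i j, b i j = b j i
  triangle : ∀ i j k, b i j ≤ b i k + b k j

end CollabGEM

end

namespace CollabGEM

/-! ### Second-moment comparison of measures -/

/-- `(∫ f dP)² ≤ c ∫ f² dQ` for all `f ≥ 0`; the least such `c` is `1 + χ²(P, Q)`. -/
def SqBound {α : Type*} [MeasurableSpace α] (P Q : Measure α) (c : ℝ≥0∞) : Prop :=
  ∀ f : α → ℝ≥0∞, Measurable f → (∫⁻ x, f x ∂P) ^ 2 ≤ c * ∫⁻ x, f x ^ 2 ∂Q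

theorem ennreal_rpow_half_sq (x : ℝ≥0∞) : (x ^ (1 / 2 : ℝ)) ^ 2 = x := by
  rw [← ENNReal.rpow_natCast, ← ENNReal.rpow_mul]; norm_num

theorem le_rpow_half_of_sq_le {a x : ℝ≥0∞} (h : a ^ 2 ≤ x) : a ≤ x ^ (1 / 2 : ℝ) := by
  have := ENNReal.rpow_le_rpow h (by norm_num : (0 : ℝ) ≤ 1 / 2)
  rwa [← ENNReal.rpow_natCast, ← ENNReal.rpow_mul,
    show ((2 : ℕ) : ℝ) * (1 / 2) = 1 by norm_num, ENNReal.rpow_one] at this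

theorem sum_sq_le_of_sq_le_mul {ι : Type*} (s : Finset ι) {a u v : ι → ℝ≥0∞}
    (h : ∀ j, a j ^ 2 ≤ u j * v j) : (∑ j ∈ s, a j) ^ 2 ≤ (∑ j ∈ s, u j) * ∑ j ∈ s, v j := by
  have h1 : ∑ j ∈ s, a j ≤ (∑ j ∈ s, u j) ^ (1 / 2 : ℝ) * (∑ j ∈ s, v j) ^ (1 / 2 : ℝ) :=
    calc ∑ j ∈ s, a j ≤ ∑ j ∈ s, u j ^ (1 / 2 : ℝ) * v j ^ (1 / 2 : ℝ) := by
          refine Finset.sum_le_sum fun j _ => ?_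
          rw [← ENNReal.mul_rpow_of_nonneg _ _ (by norm_num)]
          exact le_rpow_half_of_sq_le (h j)
      _ ≤ _ := by
          refine (ENNReal.inner_le_Lp_mul_Lq s _ _ Real.HolderConjugate.two_two).trans_eq ?_
          simp only [ENNReal.rpow_two, ennreal_rpow_half_sq]
  calc _ ≤ ((∑ j ∈ s, u j) ^ (1 / 2 : ℝ) * (∑ j ∈ s, v j) ^ (1 / 2 : ℝ)) ^ 2 := by gcongr
    _ = _ := by rw [mul_pow, ennreal_rpow_half_sq, ennreal_rpow_half_sq]

section SqBound

variable {α β : Type*} [MeasurableSpace α] [MeasurableSpace β]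

theorem SqBound.refl (P : Measure α) [IsProbabilityMeasure P] : SqBound P P 1 := by
  intro f hf
  have h := ENNReal.lintegral_mul_le_Lp_mul_Lq P Real.HolderConjugate.two_two
    hf.aemeasurable (aemeasurable_const (b := (1 : ℝ≥0∞)))
  simp only [Pi.mul_apply, mul_one, ENNReal.rpow_two, one_pow, lintegral_one, measure_univ,
    ENNReal.one_rpow] at h
  calc _ ≤ ((∫⁻ x, f x ^ 2 ∂P) ^ (1 / 2 : ℝ)) ^ 2 := by gcongr
    _ = _ := by rw [ennreal_rpow_half_sq, one_mul]

theorem SqBound.map {P Q : Measure α} {c : ℝ≥0∞} (h : SqBound P Q c) {g : α → β}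
    (hg : Measurable g) : SqBound (P.map g) (Q.map g) c := by
  intro f hf
  rw [lintegral_map hf hg, lintegral_map (hf.pow_const 2) hg]
  exact h _ (hf.comp hg)

theorem SqBound.sum_smul {ι : Type*} (s : Finset ι) {P Q : ι → Measure α} {c : ι → ℝ≥0∞}
    (w : ι → ℝ≥0∞) (h : ∀ j, SqBound (P j) (Q j) (c j)) :
    SqBound (∑ j ∈ s, w j • P j) (∑ j ∈ s, w j • Q j) (∑ j ∈ s, w j * c j) := by
  intro f hf
  simp only [lintegral_finsetSum_measure, lintegral_smul_measure, smul_eq_mul]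
  refine sum_sq_le_of_sq_le_mul s fun j => ?_
  calc _ = w j * w j * (∫⁻ x, f x ∂P j) ^ 2 := by ring
    _ ≤ w j * w j * (c j * ∫⁻ x, f x ^ 2 ∂Q j) := by gcongr; exact h j f hf
    _ = _ := by ring

theorem SqBound.prod {P Q : Measure α} {P' Q' : Measure β} [SFinite P] [SFinite Q] [SFinite P']
    [SFinite Q'] {c c' : ℝ≥0∞} (h : SqBound P Q c) (h' : SqBound P' Q' c') :
    SqBound (P.prod P') (Q.prod Q') (c * c') := by
  intro f hf
  rw [lintegral_prod _ hf.aemeasurable, lintegral_prod _ (hf.pow_const 2).aemeasurable]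
  calc _ ≤ c * ∫⁻ x, (∫⁻ y, f (x, y) ∂P') ^ 2 ∂Q := h _ hf.lintegral_prod_right'
    _ ≤ c * ∫⁻ x, c' * ∫⁻ y, f (x, y) ^ 2 ∂Q' ∂Q := by
        gcongr with x; exact h' _ (hf.comp measurable_prodMk_left)
    _ = _ := by
        rw [lintegral_const_mul _ (hf.pow_const 2).lintegral_prod_right', mul_assoc]

theorem SqBound.pi {ι : Type*} [Fintype ι] {X : ι → Type*} [∀ i, MeasurableSpace (X i)]
    {P Q : ∀ i, Measure (X i)} [∀ i, IsProbabilityMeasure (P i)]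
    [∀ i, IsProbabilityMeasure (Q i)] {c : ι → ℝ≥0∞} (h : ∀ i, SqBound (P i) (Q i) (c i)) :
    SqBound (Measure.pi P) (Measure.pi Q) (∏ i, c i) := by
  classical
  intro f hf
  have hX : Nonempty (∀ i, X i) := ⟨fun i => (nonempty_of_isProbabilityMeasure (P i)).some⟩
  have key : ∀ (s : Finset ι) (x : ∀ i, X i),
      (∫⋯∫⁻_s, f ∂P) x ^ 2 ≤ (∏ i ∈ s, c i) * (∫⋯∫⁻_s, (fun x => f x ^ 2) ∂Q) x := by
    intro s
    induction s using Finset.induction with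
    | empty => intro x; simp
    | insert i s hi ih =>
      intro x
      rw [lmarginal_insert _ hf hi, lmarginal_insert _ (hf.pow_const 2) hi,
        Finset.prod_insert hi]
      have hm := (hf.lmarginal P (s := s)).comp (measurable_update x (a := i))
      have hm' := ((hf.pow_const 2).lmarginal Q (s := s)).comp (measurable_update x (a := i))
      calc _ ≤ c i * ∫⁻ y, (∫⋯∫⁻_s, f ∂P) (Function.update x i y) ^ 2 ∂Q i := h i _ hm
        _ ≤ c i * ∫⁻ y, (∏ j ∈ s, c j) *
              (∫⋯∫⁻_s, (fun x => f x ^ 2) ∂Q) (Function.update x i y) ∂Q i := by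
            gcongr with y; exact ih _
        _ = _ := by
            rw [mul_assoc]
            congr 1
            exact lintegral_const_mul _ hm'
  have := key Finset.univ hX.some
  rwa [← lintegral_eq_lmarginal_univ, ← lintegral_eq_lmarginal_univ] at this

/-- Two measures that are both close to `Q` are not separated by a test with errors `1/4`. -/
theorem SqBound.le_of_test {P P' Q : Measure α} [IsProbabilityMeasure P]
    [IsProbabilityMeasure P'] [IsProbabilityMeasure Q] {c : ℝ≥0∞} (h : SqBound P Q c)
    (h' : SqBound P' Q c) {f f' : α → ℝ≥0∞} (hf : Measurable f) (hf' : Measurable f')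
    (hff : ∀ x, 1 ≤ f x + f' x) (h1 : ∫⁻ x, f x ∂P ≤ 1 / 4) (h2 : ∫⁻ x, f' x ∂P' ≤ 1 / 4) :
    9 / 8 ≤ c := by
  have q14 : (1 / 4 : ℝ≥0∞) ≠ ∞ := by simp
  have step : ∀ (ν : Measure α) [IsProbabilityMeasure ν], SqBound ν Q c →
      ∀ g k : α → ℝ≥0∞, Measurable g → Measurable k → (∀ x, 1 ≤ g x + k x) →
      (∀ x, k x ≤ 1) → ∫⁻ x, g x ∂ν ≤ 1 / 4 → (3 / 4) ^ 2 ≤ c * ∫⁻ x, k x ∂Q := by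
    intro ν _ hR g k hg hk hgk hk1 hR1
    have h3 : (1 : ℝ≥0∞) ≤ 1 / 4 + ∫⁻ x, k x ∂ν := by
      calc (1 : ℝ≥0∞) = ∫⁻ _, 1 ∂ν := by simp
        _ ≤ ∫⁻ x, g x + k x ∂ν := lintegral_mono hgk
        _ = _ := lintegral_add_left hg _
        _ ≤ _ := by gcongr
    have h4 : (3 / 4 : ℝ≥0∞) ≤ ∫⁻ x, k x ∂ν := by
      refine (ENNReal.add_le_add_iff_left q14).1 (le_trans (le_of_eq ?_) h3)
      rw [ENNReal.div_add_div_same, show (1 : ℝ≥0∞) + 3 = 4 by norm_num,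
        ENNReal.div_self (by norm_num) (by norm_num)]
    calc _ ≤ (∫⁻ x, k x ∂ν) ^ 2 := by gcongr
      _ ≤ c * ∫⁻ x, k x ^ 2 ∂Q := hR k hk
      _ ≤ _ := by
        gcongr with x
        calc k x ^ 2 = k x * k x := sq _
          _ ≤ k x * 1 := by gcongr; exact hk1 x
          _ = k x := mul_one _
  have hm : Measurable fun x => min (f x) 1 := hf.min measurable_const
  have hm' : Measurable fun x => 1 - min (f x) 1 := measurable_const.sub hm
  have hsum : ∀ x, min (f x) 1 + (1 - min (f x) 1) = 1 := fun x =>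
    add_tsub_cancel_of_le (min_le_right _ _)
  have a1 := step P h (fun x => min (f x) 1) (fun x => 1 - min (f x) 1) hm hm'
    (fun x => (hsum x).ge) (fun x => tsub_le_self)
    ((lintegral_mono fun x => min_le_left _ _).trans h1)
  have a2 := step P' h' f' (fun x => min (f x) 1) hf' hm (fun x => by
      rcases le_total (f x) 1 with h | h
      · rw [min_eq_left h, add_comm]; exact hff x
      · rw [min_eq_right h]; exact le_add_self) (fun x => min_le_right _ _) h2
  calc (9 / 8 : ℝ≥0∞) = (3 / 4) ^ 2 + (3 / 4) ^ 2 := by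
        rw [← ENNReal.toReal_eq_toReal_iff' (by finiteness) (by finiteness),
          ENNReal.toReal_add (by finiteness) (by finiteness)]
        norm_num
    _ ≤ c * ∫⁻ x, 1 - min (f x) 1 ∂Q + c * ∫⁻ x, min (f x) 1 ∂Q := add_le_add a1 a2
    _ = c := by
      rw [← mul_add, ← lintegral_add_left hm']
      simp only [tsub_add_cancel_of_le (min_le_right (f _) 1), lintegral_one, measure_univ,
        mul_one]

end SqBound

/-! ### Distributions on two points -/

section Bernoulli

variable {α : Type*} [MeasurableSpace α]

/-- The law that gives mass `p` to `ξ` and mass `1 - p` to `ξ'`. -/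
noncomputable def twoPoint (ξ ξ' : α) (p : ℝ) : Measure α :=
  ENNReal.ofReal p • Measure.dirac ξ + ENNReal.ofReal (1 - p) • Measure.dirac ξ'

variable {ξ ξ' : α} {p : ℝ}

theorem isProbabilityMeasure_twoPoint (h0 : 0 ≤ p) (h1 : p ≤ 1) :
    IsProbabilityMeasure (twoPoint ξ ξ' p) := by
  constructor
  simp only [twoPoint, Measure.coe_add, Measure.coe_smul, Pi.add_apply, Pi.smul_apply,
    measure_univ, smul_eq_mul, mul_one]
  rw [← ENNReal.ofReal_add h0 (by linarith)]
  simp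

variable [MeasurableSingletonClass α]

theorem lintegral_twoPoint (f : α → ℝ≥0∞) :
    ∫⁻ z, f z ∂twoPoint ξ ξ' p = ENNReal.ofReal p * f ξ + ENNReal.ofReal (1 - p) * f ξ' := by
  simp [twoPoint, lintegral_add_measure]

variable {E : Type*} [NormedAddCommGroup E]

theorem integrable_twoPoint (f : α → E) : Integrable f (twoPoint ξ ξ' p) :=
  ((integrable_dirac (by simp)).smul_measure ENNReal.ofReal_ne_top).add_measure
    ((integrable_dirac (by simp)).smul_measure ENNReal.ofReal_ne_top)

theorem integral_twoPoint [NormedSpace ℝ E] [CompleteSpace E] (h0 : 0 ≤ p) (h1 : p ≤ 1)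
    (f : α → E) : ∫ z, f z ∂twoPoint ξ ξ' p = p • f ξ + (1 - p) • f ξ' := by
  rw [twoPoint, integral_add_measure
    ((integrable_dirac (by simp)).smul_measure ENNReal.ofReal_ne_top)
    ((integrable_dirac (by simp)).smul_measure ENNReal.ofReal_ne_top)]
  simp [integral_smul_measure, h0, h1]

theorem sqBound_twoPoint {p₀ v : ℝ} (h0 : 0 ≤ p) (h1 : p ≤ 1) (hp₀ : 0 < p₀) (hp₀' : p₀ < 1)
    (hv : (p - p₀) ^ 2 / (p₀ * (1 - p₀)) ≤ v) :
    SqBound (twoPoint ξ ξ' p) (twoPoint ξ ξ' p₀) (ENNReal.ofReal (1 + v)) := by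
  intro f hf
  have hq : 0 < 1 - p₀ := by linarith
  have hv1 : p ^ 2 / p₀ + (1 - p) ^ 2 / (1 - p₀) ≤ 1 + v := by
    have : p ^ 2 / p₀ + (1 - p) ^ 2 / (1 - p₀) = 1 + (p - p₀) ^ 2 / (p₀ * (1 - p₀)) := by
      field_simp
      ring
    linarith
  have aux : ∀ (a b : ℝ) (y : ℝ≥0∞), 0 ≤ a → 0 < b →
      (ENNReal.ofReal a * y) ^ 2 ≤ ENNReal.ofReal (a ^ 2 / b) * (ENNReal.ofReal b * y ^ 2) := by
    intro a b y ha hb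
    rw [← mul_assoc, ← ENNReal.ofReal_mul (by positivity), mul_pow, div_mul_cancel₀ _ hb.ne',
      ENNReal.ofReal_pow ha]
  have key := sum_sq_le_of_sq_le_mul (Finset.univ : Finset (Fin 2))
    (a := ![ENNReal.ofReal p * f ξ, ENNReal.ofReal (1 - p) * f ξ'])
    (u := ![ENNReal.ofReal (p ^ 2 / p₀), ENNReal.ofReal ((1 - p) ^ 2 / (1 - p₀))])
    (v := ![ENNReal.ofReal p₀ * f ξ ^ 2, ENNReal.ofReal (1 - p₀) * f ξ' ^ 2])
    (by
      intro j
      fin_cases j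
      · exact aux p p₀ _ h0 hp₀
      · exact aux (1 - p) (1 - p₀) _ (by linarith) hq)
  simp only [Fin.sum_univ_two, Matrix.cons_val_zero, Matrix.cons_val_one] at key
  rw [lintegral_twoPoint, lintegral_twoPoint]
  refine key.trans ?_
  rw [← ENNReal.ofReal_add (by positivity) (by positivity)]
  gcongr

end Bernoulli

variable {D N d : ℕ} {Ξ : Set (Vec D)}

theorem distH_twoPoint_le {H : Set (Ξ → Vec d)} (hH : H ⊆ locBounded Ξ d) {ξ ξ' : Ξ}
    (hξ : dist ξ ξ' ≤ 1) {p q b : ℝ} (hp0 : 0 ≤ p) (hp1 : p ≤ 1) (hq0 : 0 ≤ q) (hq1 : q ≤ 1)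
    (hb : |p - q| ≤ b) :
    distH H (twoPoint ξ ξ' p) (twoPoint ξ ξ' q) ≤ ENNReal.ofReal b := by
  refine iSup₂_le fun h hh => iSup₂_le fun _ _ => ?_
  have hdiam : dist (h ξ) (h ξ') ≤ 1 := by
    have h1 : edist (h ξ) (h ξ') ≤ 1 :=
      (Metric.edist_le_ediam_of_mem (Set.mem_image_of_mem h (Metric.mem_closedBall_self zero_le_one))
        (Set.mem_image_of_mem h (by rwa [Metric.mem_closedBall, dist_comm]))).trans (hH hh ξ)
    rw [edist_dist] at h1
    simpa using h1
  rw [integral_twoPoint hp0 hp1, integral_twoPoint hq0 hq1,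
    show p • h ξ + (1 - p) • h ξ' - (q • h ξ + (1 - q) • h ξ') = (p - q) • (h ξ - h ξ') by module,
    ← ofReal_norm, norm_smul, Real.norm_eq_abs, ← dist_eq_norm]
  refine ENNReal.ofReal_le_ofReal ?_
  calc _ ≤ |p - q| * 1 := by gcongr
    _ ≤ b := by linarith

/-! ### Testing two problems that share their loss -/

theorem Problem.measurable_reply (p : Problem N d Ξ) (o : Oracle) :
    Measurable fun z : (Fin N → Vec d) × Draw N Ξ o => p.reply o z.1 z.2 := by
  refine measurable_pi_lambda _ fun s => ?_
  have h1 : Measurable fun z : (Fin N → Vec d) × Draw N Ξ o => z.2 s :=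
    (measurable_pi_apply s).comp measurable_snd
  have hev : Measurable fun z : Fin N × (Fin N → Vec d) => z.2 z.1 :=
    measurable_from_prod_countable_right fun j => measurable_pi_apply j
  have hy : Measurable fun z : (Fin N → Vec d) × Draw N Ξ o => z.1 (z.2 s).1 :=
    hev.comp ((measurable_fst.comp h1).prodMk measurable_fst)
  have hξ : Measurable fun z : (Fin N → Vec d) × Draw N Ξ o => (z.2 s).2 :=
    measurable_snd.comp h1
  exact (measurable_fst.comp h1).prodMk (hy.prodMk (hξ.prodMk
    ((p.measurable_loss.comp (hy.prodMk hξ)).prodMk (p.measurable_grad.comp (hy.prodMk hξ)))))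

theorem Algorithm.measurable_replies {o : Oracle} {K : ℕ} (A : Algorithm N d Ξ o K)
    (p : Problem N d Ξ) (k : ℕ) :
    Measurable fun z : A.Seed × (Fin k → Draw N Ξ o) => A.replies p z.1 k z.2 := by
  induction k with
  | zero => exact measurable_pi_lambda _ fun s => s.elim0
  | succ k ih =>
    have hinit : Measurable fun z : A.Seed × (Fin (k + 1) → Draw N Ξ o) =>
        A.replies p z.1 k (Fin.init z.2) :=
      ih.comp (measurable_fst.prodMk (measurable_pi_lambda _ fun s =>
        (measurable_pi_apply s.castSucc).comp measurable_snd))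
    refine measurable_pi_lambda _ fun s => ?_
    refine Fin.lastCases ?_ (fun s => ?_) s
    · simp only [Algorithm.replies, Fin.snoc_last]
      exact (p.measurable_reply o).comp
        (((A.measurable_query k).comp (measurable_fst.prodMk hinit)).prodMk
          ((measurable_pi_apply (Fin.last k)).comp measurable_snd))
    · simp only [Algorithm.replies, Fin.snoc_castSucc]
      exact (measurable_pi_apply s).comp hinit

theorem Algorithm.measurable_answer {o : Oracle} {K : ℕ} (A : Algorithm N d Ξ o K)
    (p : Problem N d Ξ) :
    Measurable fun z : A.Seed × (Fin K → Draw N Ξ o) => A.output z.1 (A.replies p z.1 K z.2) :=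
  A.measurable_output.comp (measurable_fst.prodMk (A.measurable_replies p K))

theorem Problem.reply_congr {p q : Problem N d Ξ} (hl : p.loss = q.loss) (hg : p.grad = q.grad)
    (o : Oracle) : p.reply o = q.reply o := by
  funext y w s
  simp only [Problem.reply, hl, hg]

theorem Algorithm.replies_congr {o : Oracle} {K : ℕ} (A : Algorithm N d Ξ o K)
    {p q : Problem N d Ξ} (hl : p.loss = q.loss) (hg : p.grad = q.grad) (ω : A.Seed) (k : ℕ) :
    A.replies p ω k = A.replies q ω k := by
  induction k with
  | zero => rfl
  | succ k ih =>
    funext w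
    simp only [Algorithm.replies, ih, Problem.reply_congr hl hg]

theorem isProbabilityMeasure_sampleLaw (hN : N ≠ 0) (o : Oracle) (P : Fin N → Measure Ξ)
    [∀ j, IsProbabilityMeasure (P j)] (s : Fin (o.perCall N)) :
    IsProbabilityMeasure (o.sampleLaw P s) := by
  cases o with
  | sync =>
    exact Measure.isProbabilityMeasure_map (μ := P (Fin.cast rfl s))
      measurable_prodMk_left.aemeasurable
  | async =>
    constructor
    have : ∀ j, (P j).map (Prod.mk j) Set.univ = 1 := fun j =>
      (Measure.isProbabilityMeasure_map measurable_prodMk_left.aemeasurable).measure_univ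
    simp only [Oracle.sampleLaw, Measure.coe_finsetSum, Finset.sum_apply, Measure.smul_apply,
      this, smul_eq_mul, mul_one, Finset.sum_const, Finset.card_univ, Fintype.card_fin,
      nsmul_eq_mul]
    exact ENNReal.mul_inv_cancel (by simpa using hN) (by simp)

theorem isProbabilityMeasure_drawsLaw (hN : N ≠ 0) (o : Oracle) (P : Fin N → Measure Ξ)
    [∀ j, IsProbabilityMeasure (P j)] (K : ℕ) : IsProbabilityMeasure (drawsLaw o P K) := by
  have := isProbabilityMeasure_sampleLaw hN o P
  unfold drawsLaw
  infer_instance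

theorem sqBound_drawsLaw (hN : N ≠ 0) (o : Oracle) {P Q : Fin N → Measure Ξ}
    [∀ j, IsProbabilityMeasure (P j)] [∀ j, IsProbabilityMeasure (Q j)] {v : Fin N → ℝ}
    (hv : ∀ j, 0 ≤ v j) (h : ∀ j, SqBound (P j) (Q j) (ENNReal.ofReal (1 + v j))) (K : ℕ) :
    SqBound (drawsLaw o P K) (drawsLaw o Q K)
      (ENNReal.ofReal (Real.exp ((K * o.perCall N : ℕ) * ((∑ j, v j) / N)))) := by
  have iP := isProbabilityMeasure_sampleLaw hN o P
  have iQ := isProbabilityMeasure_sampleLaw hN o Q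
  have hmk : ∀ j : Fin N, Measurable (Prod.mk j : Ξ → Fin N × Ξ) := fun j => measurable_prodMk_left
  have hN' : (N : ℝ) ≠ 0 := by exact_mod_cast hN
  have hcall : ∃ c : Fin (o.perCall N) → ℝ≥0∞,
      (∀ s, SqBound (o.sampleLaw P s) (o.sampleLaw Q s) (c s)) ∧
      ∏ s, c s ≤ ENNReal.ofReal (Real.exp (o.perCall N * ((∑ j, v j) / N))) := by
    cases o with
    | sync =>
      refine ⟨fun j => ENNReal.ofReal (1 + v j), fun j => (h j).map (hmk j), ?_⟩
      rw [← ENNReal.ofReal_prod_of_nonneg fun j _ => by linarith [hv j]]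
      refine ENNReal.ofReal_le_ofReal ?_
      simp only [Oracle.perCall]
      rw [mul_div_cancel₀ _ hN', Real.exp_sum]
      exact Finset.prod_le_prod (fun j _ => by linarith [hv j])
        fun j _ => by linarith [Real.add_one_le_exp (v j)]
    | async =>
      refine ⟨fun _ => ∑ j, (N : ℝ≥0∞)⁻¹ * ENNReal.ofReal (1 + v j),
        fun s => SqBound.sum_smul _ _ fun j => (h j).map (hmk j), ?_⟩
      have hcard : (Finset.univ : Finset (Fin (Oracle.async.perCall N))).card = 1 :=
        Finset.card_fin 1
      simp only [Finset.prod_const, hcard, pow_one]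
      simp only [Oracle.perCall, Nat.cast_one, one_mul]
      rw [← Finset.mul_sum, ← ENNReal.ofReal_sum_of_nonneg fun j _ => by linarith [hv j],
        ← ENNReal.ofReal_natCast N, ← ENNReal.ofReal_inv_of_pos (by positivity),
        ← ENNReal.ofReal_mul (by positivity)]
      refine ENNReal.ofReal_le_ofReal ?_
      have : (N : ℝ)⁻¹ * ∑ j, (1 + v j) = (∑ j, v j) / N + 1 := by
        simp only [Finset.sum_add_distrib, Finset.sum_const, Finset.card_univ, Fintype.card_fin,
          nsmul_eq_mul]
        field_simp
        ring
      rw [this]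
      exact Real.add_one_le_exp _
  obtain ⟨c, hc, hc'⟩ := hcall
  intro f hf
  refine (SqBound.pi (fun _ : Fin K => SqBound.pi hc) f hf).trans ?_
  gcongr
  · simp only [Finset.prod_const, Finset.card_univ, Fintype.card_fin]
    calc _ ≤ ENNReal.ofReal (Real.exp (o.perCall N * ((∑ j, v j) / N))) ^ K := by gcongr
      _ = _ := by
        rw [← ENNReal.ofReal_pow (Real.exp_nonneg _), ← Real.exp_nat_mul]
        push_cast
        rw [mul_assoc]
  · rfl

/-- If a method solves two problems that share their loss up to `ε`, and no point is good for both
of them, then the samples tell these problems apart. -/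
theorem Algorithm.exp_ge_of_error_le {o : Oracle} {K : ℕ} (A : Algorithm N d Ξ o K)
    {p q : Problem N d Ξ} (hl : p.loss = q.loss) (hg : p.grad = q.grad) {i : Fin N} {ε : ℝ}
    (hε : 0 < ε) {Q : Fin N → Measure Ξ} [∀ j, IsProbabilityMeasure (Q j)] {v : Fin N → ℝ}
    (hv : ∀ j, 0 ≤ v j)
    (hp : ∀ j, SqBound (p.dist j) (Q j) (ENNReal.ofReal (1 + v j)))
    (hq : ∀ j, SqBound (q.dist j) (Q j) (ENNReal.ofReal (1 + v j)))
    (hmp : Measurable (p.obj i)) (hmq : Measurable (q.obj i))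
    (hgap : ∀ x, 4 * ε ≤ (p.obj i x - ⨅ y, p.obj i y) + (q.obj i x - ⨅ y, q.obj i y))
    (h1 : A.error p i ≤ ENNReal.ofReal ε) (h2 : A.error q i ≤ ENNReal.ofReal ε) :
    9 / 8 ≤ Real.exp ((K * o.perCall N : ℕ) * ((∑ j, v j) / N)) := by
  have hN : N ≠ 0 := fun h => (h ▸ i : Fin 0).elim0
  have := p.prob
  have := q.prob
  have ip := isProbabilityMeasure_drawsLaw hN o p.dist K
  have iq := isProbabilityMeasure_drawsLaw hN o q.dist K
  have iQ := isProbabilityMeasure_drawsLaw hN o Q K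
  have bp := (SqBound.refl A.seedLaw).prod (sqBound_drawsLaw hN o hv hp K)
  have bq := (SqBound.refl A.seedLaw).prod (sqBound_drawsLaw hN o hv hq K)
  set out := fun z : A.Seed × (Fin K → Draw N Ξ o) => A.output z.1 (A.replies p z.1 K z.2)
  have hout : Measurable out := A.measurable_answer p
  have hfin : ENNReal.ofReal (4 * ε) ≠ 0 := by simpa using hε
  have scale : ∀ (ν : Measure (A.Seed × (Fin K → Draw N Ξ o))) (F : Vec d → ℝ), Measurable F →
      ∫⁻ z, ENNReal.ofReal (F (out z)) ∂ν ≤ ENNReal.ofReal ε →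
      ∫⁻ z, ENNReal.ofReal (F (out z)) / ENNReal.ofReal (4 * ε) ∂ν ≤ 1 / 4 := by
    intro ν F hF h
    simp only [div_eq_mul_inv]
    rw [lintegral_mul_const _ (show Measurable fun z => ENNReal.ofReal (F (out z)) from
      (hF.comp hout).ennreal_ofReal)]
    calc _ ≤ ENNReal.ofReal ε * (ENNReal.ofReal (4 * ε))⁻¹ := by gcongr
      _ = 1 * 4⁻¹ := by
        rw [← ENNReal.ofReal_inv_of_pos (by positivity), ← ENNReal.ofReal_mul hε.le,
          show ε * (4 * ε)⁻¹ = (4 : ℝ)⁻¹ by field_simp, ENNReal.ofReal_inv_of_pos (by norm_num)]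
        simp
  have e2 : A.error q i = ∫⁻ z, ENNReal.ofReal (q.obj i (out z) - ⨅ x, q.obj i x)
      ∂(A.seedLaw.prod (drawsLaw o q.dist K)) := by
    simp only [Algorithm.error, out, A.replies_congr hl hg]
  have := SqBound.le_of_test bp bq
    (f := fun z => ENNReal.ofReal (p.obj i (out z) - ⨅ x, p.obj i x) / ENNReal.ofReal (4 * ε))
    (f' := fun z => ENNReal.ofReal (q.obj i (out z) - ⨅ x, q.obj i x) / ENNReal.ofReal (4 * ε))
    (((hmp.sub_const _).comp hout).ennreal_ofReal.div_const _)
    (((hmq.sub_const _).comp hout).ennreal_ofReal.div_const _)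
    (fun z => by
      rw [ENNReal.div_add_div_same, ENNReal.le_div_iff_mul_le (Or.inl hfin)
        (Or.inl ENNReal.ofReal_ne_top),
        one_mul]
      exact (ENNReal.ofReal_le_ofReal (hgap (out z))).trans ENNReal.ofReal_add_le)
    (scale _ (fun x => p.obj i x - ⨅ y, p.obj i y) (hmp.sub_const _) h1)
    (scale _ (fun x => q.obj i x - ⨅ y, q.obj i y) (hmq.sub_const _) (e2 ▸ h2))
  rw [one_mul] at this
  have h98 : (9 / 8 : ℝ≥0∞) = ENNReal.ofReal (9 / 8) := by
    rw [ENNReal.ofReal_div_of_pos (by norm_num)]; simp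
  rwa [h98, ENNReal.ofReal_le_ofReal_iff (Real.exp_nonneg _)] at this

/-- Le Cam's two-point method for the minimax sample complexity. -/
theorem le_minimaxComplexity {o : Oracle} {C : Set (Problem N d Ξ)} {p q : Problem N d Ξ}
    (hpC : p ∈ C) (hqC : q ∈ C) {i : Fin N} {ε t : ℝ}
    (h : ∀ (K : ℕ) (A : Algorithm N d Ξ o K), A.error p i ≤ ENNReal.ofReal ε →
      A.error q i ≤ ENNReal.ofReal ε → t ≤ (K * o.perCall N : ℕ)) :
    ENNReal.ofReal t ≤ minimaxComplexity o C i ε := by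
  refine le_iInf fun M => ?_
  by_contra! hlt
  have hlt' : ∀ p' ∈ C, M.sampleComplexity p' i ε < ENNReal.ofReal t := fun p' hp' =>
    lt_of_le_of_lt (le_iSup₂_of_le p' hp' le_rfl) hlt
  have ex : ∀ p' ∈ C, ∃ K : ℕ, (∀ K', K ≤ K' → (M K').error p' i ≤ ENNReal.ofReal ε) ∧
      ((K * o.perCall N : ℕ) : ℝ) < t := by
    intro p' hp'
    obtain ⟨K, hK⟩ := iInf_lt_iff.1 (hlt' p' hp')
    obtain ⟨hK1, hK2⟩ := iInf_lt_iff.1 hK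
    refine ⟨K, hK1.2, ?_⟩
    rw [← ENNReal.ofReal_natCast] at hK2
    exact (ENNReal.ofReal_lt_ofReal_iff_of_nonneg (by positivity)).1 hK2
  obtain ⟨K, hK, hKt⟩ := ex p hpC
  obtain ⟨K', hK', hKt'⟩ := ex q hqC
  have := h _ (M (max K K')) (hK _ (le_max_left _ _)) (hK' _ (le_max_right _ _))
  rcases max_choice K K' with e | e <;> rw [e] at this <;> linarith

/-! ### Problems with distributions on two points -/

theorem eq_gradient_of_subgradient {n : ℕ} {φ : Vec n → ℝ} {x g : Vec n}
    (h : ∀ y, φ x + inner ℝ g (y - x) ≤ φ y) (hd : DifferentiableAt ℝ φ x) :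
    g = gradient φ x := by
  have hinner : HasFDerivAt (fun y : Vec n => inner ℝ g y) (innerSL ℝ g) x :=
    (innerSL ℝ g).hasFDerivAt
  have hmin : IsLocalMin (fun y => φ y - inner ℝ g y) x := by
    refine Filter.Eventually.of_forall fun y => ?_
    have := h y
    rw [inner_sub_right] at this
    simp only
    linarith
  have h0 := hmin.fderiv_eq_zero
  rw [HasFDerivAt.fderiv (f := fun y => φ y - inner ℝ g y) (hd.hasFDerivAt.sub hinner),
    sub_eq_zero] at h0
  refine (HasGradientAt.gradient ?_).symm
  rw [hasGradientAt_iff_hasFDerivAt]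
  have := hd.hasFDerivAt
  rw [h0] at this
  exact this

theorem Problem.convexOn_obj (p : Problem N d Ξ) (i : Fin N) :
    ConvexOn ℝ Set.univ (p.obj i) := by
  refine ⟨convex_univ, fun x _ y _ a b ha hb hab => ?_⟩
  set z := a • x + b • y with hz
  set g := ∫ ξ, p.grad z ξ ∂p.dist i
  have hx : p.obj i z + inner ℝ g (x - z) ≤ p.obj i x := p.subgrad i z x
  have hy : p.obj i z + inner ℝ g (y - z) ≤ p.obj i y := p.subgrad i z y
  have h0 : a * inner ℝ g (x - z) + b * inner ℝ g (y - z) = 0 := by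
    rw [← real_inner_smul_right, ← real_inner_smul_right, ← inner_add_right,
      show a • (x - z) + b • (y - z) = (0 : Vec d) by
        rw [smul_sub, smul_sub, sub_add_sub_comm, ← hz, ← add_smul, hab, one_smul, sub_self],
      inner_zero_right]
  have := add_le_add (mul_le_mul_of_nonneg_left hx ha) (mul_le_mul_of_nonneg_left hy hb)
  have e : a * p.obj i z + b * p.obj i z = p.obj i z := by rw [← add_mul, hab, one_mul]
  simp only [smul_eq_mul]
  linarith

theorem Problem.MinimizersIn.iInf_le {p : Problem N d Ξ} {r : ℝ} (h : p.MinimizersIn r)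
    (i : Fin N) (x : Vec d) : ⨅ y, p.obj i y ≤ p.obj i x := by
  obtain ⟨m, hm, -⟩ := h i
  exact ciInf_le ⟨_, Set.forall_mem_range.2 hm⟩ x

/-- The problem with a loss that is convex in its first argument, where agent `j` draws `ξ` with
probability `P j` and `ξ'` otherwise. -/
noncomputable def twoPointProblem (ξ ξ' : Ξ) (P : Fin N → ℝ) (h0 : ∀ j, 0 ≤ P j)
    (h1 : ∀ j, P j ≤ 1) (loss : Vec d → Ξ → ℝ) (grad : Vec d → Ξ → Vec d)
    (hl : Measurable (Function.uncurry loss)) (hg : Measurable (Function.uncurry grad))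
    (hsub : ∀ x z y, loss x z + inner ℝ (grad x z) (y - x) ≤ loss y z) : Problem N d Ξ where
  dist j := twoPoint ξ ξ' (P j)
  loss := loss
  grad := grad
  prob j := isProbabilityMeasure_twoPoint (h0 j) (h1 j)
  measurable_loss := hl
  measurable_grad := hg
  integrable_loss _ _ := integrable_twoPoint _
  integrable_grad _ _ := integrable_twoPoint _
  grad_eq x z hd := eq_gradient_of_subgradient (fun y => hsub x z y) hd
  subgrad j x y := by
    have hq : 0 ≤ 1 - P j := by linarith [h1 j]
    rw [integral_twoPoint (h0 j) (h1 j), integral_twoPoint (h0 j) (h1 j),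
      integral_twoPoint (h0 j) (h1 j), inner_add_left, real_inner_smul_left,
      real_inner_smul_left]
    simp only [smul_eq_mul]
    have := add_le_add (mul_le_mul_of_nonneg_left (hsub x ξ y) (h0 j))
      (mul_le_mul_of_nonneg_left (hsub x ξ' y) hq)
    linarith

section TwoPointProblem

variable {ξ ξ' : Ξ} {P : Fin N → ℝ} {h0 : ∀ j, 0 ≤ P j} {h1 : ∀ j, P j ≤ 1}
  {loss : Vec d → Ξ → ℝ} {grad : Vec d → Ξ → Vec d} {hl : Measurable (Function.uncurry loss)}
  {hg : Measurable (Function.uncurry grad)}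
  {hsub : ∀ x z y, loss x z + inner ℝ (grad x z) (y - x) ≤ loss y z}

theorem twoPointProblem_obj (j : Fin N) (x : Vec d) :
    (twoPointProblem ξ ξ' P h0 h1 loss grad hl hg hsub).obj j x
      = P j * loss x ξ + (1 - P j) * loss x ξ' :=
  integral_twoPoint (h0 j) (h1 j) _

theorem measurable_twoPointProblem_obj (j : Fin N) :
    Measurable ((twoPointProblem ξ ξ' P h0 h1 loss grad hl hg hsub).obj j) := by
  rw [funext (twoPointProblem_obj j)]
  have : ∀ z, Measurable fun x => loss x z := fun z => hl.comp measurable_prodMk_right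
  exact ((this ξ).const_mul _).add ((this ξ').const_mul _)

theorem twoPointProblem_distBias {H : Set (Ξ → Vec d)} (hH : H ⊆ locBounded Ξ d)
    (hξ : dist ξ ξ' ≤ 1) {b : Fin N → Fin N → ℝ} (hb : ∀ j k, |P j - P k| ≤ b j k) :
    (twoPointProblem ξ ξ' P h0 h1 loss grad hl hg hsub).DistBias H b := fun j k =>
  distH_twoPoint_le hH hξ (h0 j) (h1 j) (h0 k) (h1 k) (hb j k)

end TwoPointProblem

/-- How much the distribution of agent `j` is perturbed: a multiple of `(4ε - b_ij)₊`. -/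
noncomputable def perturb (b : Fin N → Fin N → ℝ) (i : Fin N) (ε c : ℝ) (j : Fin N) : ℝ :=
  c * max 0 (4 * ε - b i j)

section Perturb

variable {b : Fin N → Fin N → ℝ} {i : Fin N} {ε c : ℝ}

theorem perturb_nonneg (hc : 0 ≤ c) (j : Fin N) : 0 ≤ perturb b i ε c j :=
  mul_nonneg hc (le_max_left _ _)

theorem perturb_le (hb : IsPseudoDist b) (hc : 0 ≤ c) (hε : 0 < ε) (j : Fin N) :
    perturb b i ε c j ≤ 4 * c * ε := by
  have : max 0 (4 * ε - b i j) ≤ 4 * ε := max_le (by linarith) (by linarith [hb.nonneg i j])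
  calc perturb b i ε c j ≤ c * (4 * ε) := mul_le_mul_of_nonneg_left this hc
    _ = _ := by ring

theorem perturb_self (hb : IsPseudoDist b) (hε : 0 < ε) : perturb b i ε c i = 4 * c * ε := by
  rw [perturb, hb.self, sub_zero, max_eq_right (by linarith)]
  ring

theorem perturb_eq_zero {j : Fin N} (h : ¬ b i j / 4 ≤ ε) : perturb b i ε c j = 0 := by
  rw [perturb, max_eq_left (by linarith), mul_zero]

theorem abs_perturb_sub_le (hb : IsPseudoDist b) (hc : 0 ≤ c) (hc1 : c ≤ 1) (j k : Fin N) :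
    |perturb b i ε c j - perturb b i ε c k| ≤ b j k := by
  rw [perturb, perturb, ← mul_sub, abs_mul, abs_of_nonneg hc]
  have h1 : |max 0 (4 * ε - b i j) - max 0 (4 * ε - b i k)| ≤ b j k := by
    refine (abs_max_sub_max_le_max _ _ _ _).trans ?_
    rw [sub_self, abs_zero]
    refine max_le (hb.nonneg _ _) (abs_le.2 ?_)
    have h2 := hb.triangle i j k
    have h3 := hb.triangle i k j
    have h4 := hb.symm j k
    constructor <;> linarith
  calc _ ≤ 1 * |max 0 (4 * ε - b i j) - max 0 (4 * ε - b i k)| := by gcongr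
    _ ≤ _ := by rwa [one_mul]

end Perturb

/-- The minimax lower bound from two problems with opposite perturbations. -/
theorem le_minimaxComplexity_of_perturb {ξ ξ' : Ξ} {b : Fin N → Fin N → ℝ} {i : Fin N}
    {ε c p₀ v : ℝ} {o : Oracle} {C : Set (Problem N d Ξ)} (hb : IsPseudoDist b) (hε : 0 < ε)
    (hc : 0 ≤ c) (hp₀ : 0 < p₀) (hp₀' : p₀ ≤ 1 / 2) (hv : 0 < v)
    (hcv : 32 * c ^ 2 * ε ^ 2 / p₀ ≤ v)
    {loss : Vec d → Ξ → ℝ} {grad : Vec d → Ξ → Vec d} {hl : Measurable (Function.uncurry loss)}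
    {hg : Measurable (Function.uncurry grad)}
    {hsub : ∀ x z y, loss x z + inner ℝ (grad x z) (y - x) ≤ loss y z}
    {hp0 : ∀ j, 0 ≤ p₀ + perturb b i ε c j} {hp1 : ∀ j, p₀ + perturb b i ε c j ≤ 1}
    {hq0 : ∀ j, 0 ≤ p₀ - perturb b i ε c j} {hq1 : ∀ j, p₀ - perturb b i ε c j ≤ 1}
    (hpC : twoPointProblem ξ ξ' (fun j => p₀ + perturb b i ε c j) hp0 hp1 loss grad hl hg hsub ∈ C)
    (hqC : twoPointProblem ξ ξ' (fun j => p₀ - perturb b i ε c j) hq0 hq1 loss grad hl hg hsub ∈ C)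
    {r : ℝ} (hC : ∀ p ∈ C, p.MinimizersIn r)
    (hgap : ∃ x₁ x₂, ∀ x,
      (p₀ + 4 * c * ε) * loss x₁ ξ + (1 - (p₀ + 4 * c * ε)) * loss x₁ ξ' +
      ((p₀ - 4 * c * ε) * loss x₂ ξ + (1 - (p₀ - 4 * c * ε)) * loss x₂ ξ') + 4 * ε ≤
      2 * (p₀ * loss x ξ + (1 - p₀) * loss x ξ')) :
    ENNReal.ofReal (N / (9 * (numClose (fun j k => b j k / 4) ε i * v))) ≤
      minimaxComplexity o C i ε := by
  refine le_minimaxComplexity hpC hqC fun K A hA hA' => ?_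
  have hN : 0 < (N : ℝ) := by exact_mod_cast i.pos
  have hp₀1 : p₀ < 1 := by linarith
  have hbase : IsProbabilityMeasure (twoPoint ξ ξ' p₀) :=
    isProbabilityMeasure_twoPoint hp₀.le hp₀1.le
  have hclose : 0 < (numClose (fun j k => b j k / 4) ε i : ℝ) := by
    have : i ∈ Finset.univ.filter fun j => b i j / 4 ≤ ε := by
      simp [hb.self, hε.le]
    exact_mod_cast Finset.card_pos.2 ⟨i, this⟩
  have hdev : ∀ j, perturb b i ε c j ^ 2 / (p₀ * (1 - p₀)) ≤ if b i j / 4 ≤ ε then v else 0 := by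
    intro j
    split_ifs with hj
    · refine le_trans ?_ hcv
      rw [div_le_div_iff₀ (by nlinarith) hp₀]
      have h1 : perturb b i ε c j ^ 2 ≤ (4 * c * ε) ^ 2 :=
        pow_le_pow_left₀ (perturb_nonneg hc j) (perturb_le hb hc hε j) 2
      have h2 : p₀ * (1 / 2) ≤ p₀ * (1 - p₀) := by gcongr; linarith
      calc _ ≤ (4 * c * ε) ^ 2 * p₀ := by gcongr
        _ = 32 * c ^ 2 * ε ^ 2 * (p₀ * (1 / 2)) := by ring
        _ ≤ _ := by gcongr
    · simp [perturb_eq_zero hj]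
  obtain ⟨x₁, x₂, hgap⟩ := hgap
  have key := A.exp_ge_of_error_le
    (p := twoPointProblem ξ ξ' (fun j => p₀ + perturb b i ε c j) hp0 hp1 loss grad hl hg hsub)
    (q := twoPointProblem ξ ξ' (fun j => p₀ - perturb b i ε c j) hq0 hq1 loss grad hl hg hsub)
    (Q := fun _ => twoPoint ξ ξ' p₀)
    (v := fun j => if b i j / 4 ≤ ε then v else 0) rfl rfl hε
    (fun j => by positivity)
    (fun j => sqBound_twoPoint (hp0 j) (hp1 j) hp₀ hp₀1 (by simpa using hdev j))
    (fun j => sqBound_twoPoint (hq0 j) (hq1 j) hp₀ hp₀1 (by simpa using hdev j))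
    (measurable_twoPointProblem_obj i) (measurable_twoPointProblem_obj i)
    (fun x => by
      have e1 := (hC _ hpC).iInf_le i x₁
      have e2 := (hC _ hqC).iInf_le i x₂
      have := hgap x
      simp only [twoPointProblem_obj, perturb_self hb hε] at e1 e2 ⊢
      linarith) hA hA'
  have hsum : (∑ j, if b i j / 4 ≤ ε then v else 0)
      = numClose (fun j k => b j k / 4) ε i * v := by
    rw [← Finset.sum_filter, Finset.sum_const, nsmul_eq_mul]
    rfl
  rw [hsum, ← Real.log_le_iff_le_exp (by norm_num)] at key
  have hlog := Real.one_sub_inv_le_log_of_pos (show (0 : ℝ) < 9 / 8 by norm_num)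
  have h9 : 1 / 9 ≤ ((K * o.perCall N : ℕ) : ℝ) * (numClose (fun j k => b j k / 4) ε i * v / N) :=
    by linarith
  rw [div_le_iff₀ (by positivity)]
  rw [← mul_div_assoc, le_div_iff₀ hN] at h9
  linarith

/-! ### Absolute losses -/

section Absolute

/-- The loss `B |⟨e, x⟩ - r|` at the data item `ξ`, and `B |⟨e, x⟩ + r|` elsewhere. -/
noncomputable def absLoss (e : Vec d) (B r : ℝ) (ξ : Ξ) (x : Vec d) (z : Ξ) : ℝ :=
  open Classical in B * |inner ℝ e x - if z = ξ then r else -r|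

/-- A subgradient of `absLoss`. -/
noncomputable def absGrad (e : Vec d) (B r : ℝ) (ξ : Ξ) (x : Vec d) (z : Ξ) : Vec d :=
  open Classical in
  (if 0 ≤ inner ℝ e x - (if z = ξ then r else -r) then B else -B) • e

variable {e : Vec d} {B r : ℝ} {ξ : Ξ}

theorem measurable_absLoss_aux : Measurable fun w : Vec d × Ξ =>
    open Classical in inner ℝ e w.1 - if w.2 = ξ then r else -r := by
  classical
  have h : MeasurableSet {w : Vec d × Ξ | w.2 = ξ} := measurable_snd (measurableSet_singleton ξ)
  exact (by fun_prop : Measurable fun w : Vec d × Ξ => inner ℝ e w.1).sub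
    (Measurable.ite h measurable_const measurable_const)

theorem measurable_absLoss : Measurable (Function.uncurry (absLoss e B r ξ)) :=
  (continuous_abs.measurable.comp measurable_absLoss_aux).const_mul B

theorem measurable_absGrad : Measurable (Function.uncurry (absGrad e B r ξ)) :=
  (Measurable.ite (measurable_absLoss_aux measurableSet_Ici) measurable_const
    measurable_const).smul_const e

theorem absLoss_subgradient (hB : 0 ≤ B) (x : Vec d) (z : Ξ) (y : Vec d) :
    absLoss e B r ξ x z + inner ℝ (absGrad e B r ξ x z) (y - x) ≤ absLoss e B r ξ y z := by
  classical
  simp only [absLoss, absGrad, real_inner_smul_left, inner_sub_right]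
  generalize (if z = ξ then r else -r) = t
  split_ifs with h
  · rw [abs_of_nonneg h]
    have := mul_le_mul_of_nonneg_left (le_abs_self (inner ℝ e y - t)) hB
    linarith
  · rw [abs_of_neg (not_le.1 h)]
    have := mul_le_mul_of_nonneg_left (neg_abs_le (inner ℝ e y - t)) hB
    linarith

theorem norm_absGrad (he : ‖e‖ = 1) (hB : 0 ≤ B) (x : Vec d) (z : Ξ) :
    ‖absGrad e B r ξ x z‖ = B := by
  rw [absGrad, norm_smul, he, mul_one]
  split_ifs <;> simp [abs_of_nonneg hB]

theorem absLoss_self (x : Vec d) : absLoss e B r ξ x ξ = B * |inner ℝ e x - r| := by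
  simp [absLoss]

theorem absLoss_of_ne {ξ' : Ξ} (h : ξ' ≠ ξ) (x : Vec d) :
    absLoss e B r ξ x ξ' = B * |inner ℝ e x + r| := by
  simp [absLoss, h]

theorem absProblem_mem_convexClass {ξ' : Ξ} (hne : ξ' ≠ ξ) (hξ : dist ξ ξ' ≤ 1) (he : ‖e‖ = 1)
    (hB : 0 ≤ B) (hr : 0 ≤ r) {H : Set (Ξ → Vec d)} (hH : H ⊆ locBounded Ξ d)
    {b : Fin N → Fin N → ℝ} {P : Fin N → ℝ} {h0 : ∀ j, 0 ≤ P j} {h1 : ∀ j, P j ≤ 1}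
    (hb : ∀ j k, |P j - P k| ≤ b j k) :
    twoPointProblem ξ ξ' P h0 h1 (absLoss e B r ξ) (absGrad e B r ξ) measurable_absLoss
      measurable_absGrad (absLoss_subgradient hB) ∈ convexClass N d Ξ H r b B := by
  refine ⟨fun j => ?_, ⟨fun j => Problem.convexOn_obj _ j, fun j x => ?_⟩,
    twoPointProblem_distBias hH hξ hb⟩
  · have hee : inner ℝ e e = (1 : ℝ) := by rw [real_inner_self_eq_norm_sq, he]; norm_num
    have htri : ∀ u : ℝ, 2 * r ≤ |u - r| + |u + r| := fun u => by
      linarith [le_abs_self (u + r), neg_abs_le (u - r)]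
    have hp := h0 j
    have hq := h1 j
    simp only [twoPointProblem_obj, absLoss_self, absLoss_of_ne hne]
    rcases le_total (1 / 2) (P j) with h | h
    · refine ⟨r • e, fun y => ?_, by rw [norm_smul, he, Real.norm_of_nonneg hr, mul_one]⟩
      rw [real_inner_smul_right, hee, mul_one, sub_self, abs_zero,
        abs_of_nonneg (by linarith : 0 ≤ r + r)]
      have e1 := mul_le_mul_of_nonneg_left (htri (inner ℝ e y)) (by linarith : 0 ≤ 1 - P j)
      have e2 := mul_le_mul_of_nonneg_right (by linarith : 1 - P j ≤ P j)
        (abs_nonneg (inner ℝ e y - r))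
      have e3 := mul_le_mul_of_nonneg_left (by linarith : (1 - P j) * (r + r) ≤
        P j * |inner ℝ e y - r| + (1 - P j) * |inner ℝ e y + r|) hB
      linarith
    · refine ⟨-(r • e), fun y => ?_, by
        rw [norm_neg, norm_smul, he, Real.norm_of_nonneg hr, mul_one]⟩
      rw [inner_neg_right, real_inner_smul_right, hee, mul_one, neg_add_cancel, abs_zero,
        ← abs_neg, abs_of_nonneg (by linarith : 0 ≤ -(-r - r))]
      have e1 := mul_le_mul_of_nonneg_left (htri (inner ℝ e y)) hp
      have e2 := mul_le_mul_of_nonneg_right (by linarith : P j ≤ 1 - P j)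
        (abs_nonneg (inner ℝ e y + r))
      have e3 := mul_le_mul_of_nonneg_left (by linarith : P j * (r + r) ≤
        P j * |inner ℝ e y - r| + (1 - P j) * |inner ℝ e y + r|) hB
      linarith
  · have : IsProbabilityMeasure (twoPoint ξ ξ' (P j)) :=
      isProbabilityMeasure_twoPoint (h0 j) (h1 j)
    simp only [twoPointProblem, ← ofReal_norm, norm_absGrad he hB, ← ENNReal.ofReal_pow hB,
      lintegral_const, measure_univ, mul_one, le_refl]

theorem convexClass_lower_bound {H : Set (Ξ → Vec d)} {o : Oracle} {b : Fin N → Fin N → ℝ}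
    {ε : ℝ} {i : Fin N} (hd : 0 < d) (hΞ : ∃ ξ ∈ Ξ, ∃ ξ' ∈ Ξ, ξ ≠ ξ' ∧ dist ξ ξ' ≤ 1)
    (hH : H ⊆ locBounded Ξ d) (hb : IsPseudoDist b) (hr : 0 < r) (hB : 0 < B)
    (hrB : 1 ≤ r ^ 2 * B ^ 2) (hε : 0 < ε) (hε' : ε < 1 / 16) :
    ENNReal.ofReal (1 / 36 * B ^ 2 * r ^ 2 * N /
      (ε ^ 2 * numClose (fun j k => b j k / 4) ε i)) ≤
      minimaxComplexity o (convexClass N d Ξ H r b B) i ε := by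
  obtain ⟨z, hz, z', hz', hne, hdist⟩ := hΞ
  have hne' : (⟨z', hz'⟩ : Ξ) ≠ ⟨z, hz⟩ := fun h => hne (congrArg Subtype.val h).symm
  have hrB1 : 1 ≤ r * B := by nlinarith [mul_pos hr hB]
  set c : ℝ := 1 / (4 * (r * B)) with hc_def
  have hc : 0 < c := by positivity
  have hc1 : c ≤ 1 / 4 := by
    rw [hc_def, div_le_div_iff₀ (by positivity) (by norm_num)]; linarith
  have hcrB : c * (r * B) = 1 / 4 := by rw [hc_def]; field_simp
  have hδ : ∀ j, perturb b i ε c j ≤ 1 / 2 := fun j =>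
    (perturb_le hb hc.le hε j).trans (by nlinarith)
  have hδ0 : ∀ j, 0 ≤ perturb b i ε c j := perturb_nonneg hc.le
  have hlip := abs_perturb_sub_le (i := i) (ε := ε) hb hc.le (by linarith)
  set e : Vec d := EuclideanSpace.single ⟨0, hd⟩ 1
  have he : ‖e‖ = 1 := by simp [e]
  have key := le_minimaxComplexity_of_perturb (ξ := (⟨z, hz⟩ : Ξ)) (ξ' := ⟨z', hz'⟩) (i := i)
    (ε := ε) (c := c) (p₀ := 1 / 2) (v := 4 * ε ^ 2 / (r ^ 2 * B ^ 2)) (o := o)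
    (C := convexClass N d Ξ H r b B) hb hε hc.le (by norm_num) le_rfl (by positivity)
    (by rw [hc_def]; apply le_of_eq; field_simp; norm_num)
    (hp0 := fun j => by linarith [hδ0 j]) (hp1 := fun j => by linarith [hδ j])
    (hq0 := fun j => by linarith [hδ j]) (hq1 := fun j => by linarith [hδ0 j])
    (absProblem_mem_convexClass hne' hdist he hB.le hr.le hH fun j k => by
      simpa using hlip j k)
    (absProblem_mem_convexClass hne' hdist he hB.le hr.le hH fun j k => by
      rw [sub_sub_sub_cancel_left, abs_sub_comm]; exact hlip j k)
    (fun p hp => hp.1)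
    ⟨r • e, -(r • e), fun x => by
      have hee : inner ℝ e e = (1 : ℝ) := by rw [real_inner_self_eq_norm_sq, he]; norm_num
      simp only [absLoss_self, absLoss_of_ne hne', inner_neg_right, real_inner_smul_right, hee,
        mul_one, sub_self, neg_add_cancel, abs_zero]
      rw [← abs_neg (-r - r), abs_of_nonneg (by linarith : 0 ≤ -(-r - r)),
        abs_of_nonneg (by linarith : 0 ≤ r + r)]
      have h1 : 2 * r ≤ |inner ℝ e x - r| + |inner ℝ e x + r| := by
        linarith [le_abs_self (inner ℝ e x + r), neg_abs_le (inner ℝ e x - r)]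
      have h2 := mul_le_mul_of_nonneg_left h1 hB.le
      have h3 : c * ε * (B * r) = ε / 4 := by
        rw [show c * ε * (B * r) = c * (r * B) * ε by ring, hcrB]; ring
      linarith⟩
  refine le_trans (le_of_eq ?_) key
  congr 1
  rcases ne_or_eq (numClose (fun j k => b j k / 4) ε i : ℝ) 0 with h | h
  · field_simp; ring
  · simp [h]

end Absolute

/-! ### Quadratic losses -/

section Quadratic

/-- The loss `w/2 ‖x‖² - a (1_{z = ξ} - p₀) ⟨e, x⟩`. -/
noncomputable def quadLoss (e : Vec d) (w a p₀ : ℝ) (ξ : Ξ) (x : Vec d) (z : Ξ) : ℝ :=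
  open Classical in w / 2 * ‖x‖ ^ 2 - a * ((if z = ξ then 1 else 0) - p₀) * inner ℝ e x

/-- The gradient of `quadLoss`. -/
noncomputable def quadGrad (e : Vec d) (w a p₀ : ℝ) (ξ : Ξ) (x : Vec d) (z : Ξ) : Vec d :=
  open Classical in w • x - (a * ((if z = ξ then 1 else 0) - p₀)) • e

variable {e : Vec d} {w a p₀ : ℝ} {ξ : Ξ}

theorem measurable_quadLoss_aux : Measurable fun y : Vec d × Ξ =>
    open Classical in a * ((if y.2 = ξ then 1 else 0) - p₀) := by
  classical
  have h : MeasurableSet {y : Vec d × Ξ | y.2 = ξ} := measurable_snd (measurableSet_singleton ξ)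
  exact ((Measurable.ite h measurable_const measurable_const).sub_const p₀).const_mul a

theorem measurable_quadLoss : Measurable (Function.uncurry (quadLoss e w a p₀ ξ)) :=
  (by fun_prop : Measurable fun y : Vec d × Ξ => w / 2 * ‖y.1‖ ^ 2).sub
    (measurable_quadLoss_aux.mul (by fun_prop : Measurable fun y : Vec d × Ξ => inner ℝ e y.1))

theorem measurable_quadGrad : Measurable (Function.uncurry (quadGrad e w a p₀ ξ)) :=
  (by fun_prop : Measurable fun y : Vec d × Ξ => w • y.1).sub
    (measurable_quadLoss_aux.smul_const e)

theorem quadLoss_subgradient (hw : 0 ≤ w) (x : Vec d) (z : Ξ) (y : Vec d) :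
    quadLoss e w a p₀ ξ x z + inner ℝ (quadGrad e w a p₀ ξ x z) (y - x)
      ≤ quadLoss e w a p₀ ξ y z := by
  classical
  simp only [quadLoss, quadGrad, inner_sub_left, real_inner_smul_left, inner_sub_right,
    real_inner_self_eq_norm_sq]
  have h1 : 0 ≤ w / 2 * ‖x - y‖ ^ 2 := by positivity
  rw [norm_sub_sq_real] at h1
  linarith

theorem quadLoss_mean {ξ' : Ξ} (hne : ξ' ≠ ξ) (p : ℝ) (x : Vec d) :
    p * quadLoss e w a p₀ ξ x ξ + (1 - p) * quadLoss e w a p₀ ξ x ξ'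
      = w / 2 * ‖x‖ ^ 2 - a * (p - p₀) * inner ℝ e x := by
  simp only [quadLoss, if_true, hne, if_false]
  ring

theorem hasGradientAt_quadratic (w m : ℝ) (e x : Vec d) :
    HasGradientAt (fun y : Vec d => w / 2 * ‖y‖ ^ 2 - m * inner ℝ e y) (w • x - m • e) x := by
  rw [hasGradientAt_iff_hasFDerivAt]
  have h1 : HasFDerivAt (fun y : Vec d => ‖y‖ ^ 2) (2 • innerSL ℝ x) x :=
    (hasStrictFDerivAt_norm_sq x).hasFDerivAt
  have h2 : HasFDerivAt (fun y : Vec d => inner ℝ e y) (innerSL ℝ e) x :=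
    (innerSL ℝ e).hasFDerivAt
  refine ((h1.const_mul (w / 2)).sub (h2.const_mul m)).congr_fderiv ?_
  ext y
  simp
  ring

theorem strongConvexOn_quadratic (w m : ℝ) (e : Vec d) :
    StrongConvexOn Set.univ w fun y : Vec d => w / 2 * ‖y‖ ^ 2 - m * inner ℝ e y := by
  rw [strongConvexOn_iff_convex]
  refine ⟨convex_univ, fun x _ y _ s t _ _ _ => le_of_eq ?_⟩
  simp only [inner_add_right, real_inner_smul_right, smul_eq_mul]
  ring

theorem quadratic_eq (hw : w ≠ 0) (m : ℝ) (he : ‖e‖ = 1) (x : Vec d) :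
    w / 2 * ‖x‖ ^ 2 - m * inner ℝ e x
      = w / 2 * ‖x - (m / w) • e‖ ^ 2 - m ^ 2 / (2 * w) := by
  rw [norm_sub_sq_real, norm_smul, he, real_inner_smul_right, real_inner_comm, mul_one,
    Real.norm_eq_abs, sq_abs]
  field_simp
  ring

theorem quadProblem_mem_smoothClass {ξ' : Ξ} (hne : ξ' ≠ ξ) (hξ : dist ξ ξ' ≤ 1)
    (he : ‖e‖ = 1) (hw : 0 < w) {r σ : ℝ} {H : Set (Ξ → Vec d)} (hH : H ⊆ locBounded Ξ d)
    {b : Fin N → Fin N → ℝ} {P : Fin N → ℝ} {h0 : ∀ j, 0 ≤ P j} {h1 : ∀ j, P j ≤ 1}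
    (hb : ∀ j k, |P j - P k| ≤ b j k) (hmin : ∀ j, |a * (P j - p₀) / w| ≤ r)
    (hvar : ∀ j, a ^ 2 * (P j * (1 - P j)) ≤ σ ^ 2) :
    twoPointProblem ξ ξ' P h0 h1 (quadLoss e w a p₀ ξ) (quadGrad e w a p₀ ξ) measurable_quadLoss
      measurable_quadGrad (quadLoss_subgradient hw.le) ∈ smoothClass N d Ξ H w w r b σ := by
  set p := twoPointProblem ξ ξ' P h0 h1 (quadLoss e w a p₀ ξ) (quadGrad e w a p₀ ξ)
    measurable_quadLoss measurable_quadGrad (quadLoss_subgradient hw.le)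
  have hobj : ∀ j, p.obj j = fun x => w / 2 * ‖x‖ ^ 2 - a * (P j - p₀) * inner ℝ e x := fun j =>
    funext fun x => (twoPointProblem_obj j x).trans (quadLoss_mean hne _ x)
  have hgrad : ∀ j x, HasGradientAt (p.obj j) (w • x - (a * (P j - p₀)) • e) x := fun j x => by
    rw [hobj]; exact hasGradientAt_quadratic _ _ _ _
  refine ⟨fun j => ?_, ⟨fun j => ?_, fun j => ⟨fun x => ?_, fun x y => ?_⟩, fun j x => ?_⟩,
    twoPointProblem_distBias hH hξ hb⟩
  · refine ⟨(a * (P j - p₀) / w) • e, fun y => ?_, by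
      rw [norm_smul, he, mul_one]; exact hmin j⟩
    simp only [hobj, quadratic_eq hw.ne' _ he, sub_self, norm_zero]
    have : 0 ≤ w / 2 * ‖y - (a * (P j - p₀) / w) • e‖ ^ 2 := by positivity
    linarith
  · rw [hobj]; exact strongConvexOn_quadratic _ _ _
  · exact (hgrad j x).differentiableAt
  · rw [(hgrad j x).gradient, (hgrad j y).gradient, sub_sub_sub_cancel_right, ← smul_sub,
      norm_smul, Real.norm_of_nonneg hw.le]
  · rw [(hgrad j x).gradient]
    refine (lintegral_twoPoint _).trans_le ?_
    have hsq : ∀ t : ℝ, ‖w • x - t • e - (w • x - (a * (P j - p₀)) • e)‖ₑ ^ 2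
        = ENNReal.ofReal ((a * (P j - p₀) - t) ^ 2) := fun t => by
      rw [show w • x - t • e - (w • x - (a * (P j - p₀)) • e) = (a * (P j - p₀) - t) • e by module,
        ← ofReal_norm, norm_smul, he, mul_one, ← ENNReal.ofReal_pow (norm_nonneg _),
        Real.norm_eq_abs, sq_abs]
    simp only [p, twoPointProblem, quadGrad, hsq, if_true, hne, if_false]
    have hq : 0 ≤ 1 - P j := by linarith [h1 j]
    rw [← ENNReal.ofReal_mul (h0 j), ← ENNReal.ofReal_mul hq,
      ← ENNReal.ofReal_add (mul_nonneg (h0 j) (sq_nonneg _)) (mul_nonneg hq (sq_nonneg _))]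
    refine ENNReal.ofReal_le_ofReal (le_trans (le_of_eq ?_) (hvar j))
    ring

theorem smoothClass_lower_bound_aux {H : Set (Ξ → Vec d)} {o : Oracle} {b : Fin N → Fin N → ℝ}
    {ε r σ c v : ℝ} {i : Fin N} (hd : 0 < d)
    (hΞ : ∃ ξ ∈ Ξ, ∃ ξ' ∈ Ξ, ξ ≠ ξ' ∧ dist ξ ξ' ≤ 1)
    (hH : H ⊆ locBounded Ξ d) (hb : IsPseudoDist b) (hr : 0 < r) (hε : 0 < ε) (hε' : ε < 1 / 16)
    (hc : 0 ≤ c) (hc1 : c ≤ 1) (hp₀ : 0 < p₀) (hp₀' : p₀ ≤ 1 / 2) (hcp : 4 * c * ε ≤ p₀)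
    (ha : 0 ≤ a) (hsep : (a * (4 * c * ε) * r) ^ 2 = 4 * ε)
    (hvar : ∀ P : ℝ, 0 ≤ P → P ≤ 2 * p₀ → a ^ 2 * (P * (1 - P)) ≤ σ ^ 2) (hv : 0 < v)
    (hcv : 32 * c ^ 2 * ε ^ 2 / p₀ ≤ v) :
    ENNReal.ofReal (N / (9 * (numClose (fun j k => b j k / 4) ε i * v))) ≤
      minimaxComplexity o (smoothClass N d Ξ H (1 / r ^ 2) (1 / r ^ 2) r b σ) i ε := by
  obtain ⟨z, hz, z', hz', hne, hdist⟩ := hΞ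
  have hne' : (⟨z', hz'⟩ : Ξ) ≠ ⟨z, hz⟩ := fun h => hne (congrArg Subtype.val h).symm
  have hδ : ∀ j, perturb b i ε c j ≤ 4 * c * ε := perturb_le hb hc hε
  have hδ0 : ∀ j, 0 ≤ perturb b i ε c j := perturb_nonneg hc
  have hlip := abs_perturb_sub_le (i := i) (ε := ε) hb hc hc1
  have hw : (0 : ℝ) < 1 / r ^ 2 := by positivity
  have hnorm : a * (4 * c * ε) * r ≤ 1 := by
    rw [← sq_le_one_iff₀ (by positivity), hsep]; linarith
  have hmin : ∀ s j, |s| = perturb b i ε c j → |a * s / (1 / r ^ 2)| ≤ r := fun s j hs => by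
    rw [abs_div, abs_mul, hs, abs_of_nonneg ha, abs_of_pos hw, div_div_eq_mul_div, div_one]
    calc a * perturb b i ε c j * r ^ 2 ≤ a * (4 * c * ε) * r ^ 2 := by gcongr; exact hδ j
      _ = a * (4 * c * ε) * r * r := by ring
      _ ≤ 1 * r := by gcongr
      _ = r := one_mul r
  set e : Vec d := EuclideanSpace.single ⟨0, hd⟩ 1
  have he : ‖e‖ = 1 := by simp [e]
  refine le_minimaxComplexity_of_perturb (ξ := (⟨z, hz⟩ : Ξ)) (ξ' := ⟨z', hz'⟩) (i := i)
    (ε := ε) (c := c) (p₀ := p₀) hb hε hc hp₀ hp₀' hv hcv (r := r)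
    (hp0 := fun j => by linarith [hδ0 j]) (hp1 := fun j => by linarith [hδ j])
    (hq0 := fun j => by linarith [hδ j]) (hq1 := fun j => by linarith [hδ0 j])
    (quadProblem_mem_smoothClass (e := e) (a := a) (p₀ := p₀) hne' hdist he hw hH
      (fun j k => by simpa using hlip j k)
      (fun j => hmin _ j (by rw [add_sub_cancel_left, abs_of_nonneg (hδ0 j)]))
      fun j => hvar _ (by linarith [hδ0 j]) (by linarith [hδ j]))
    (quadProblem_mem_smoothClass (e := e) (a := a) (p₀ := p₀) hne' hdist he hw hH
      (fun j k => by rw [sub_sub_sub_cancel_left, abs_sub_comm]; exact hlip j k)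
      (fun j => hmin _ j (by rw [sub_sub_cancel_left, abs_neg, abs_of_nonneg (hδ0 j)]))
      fun j => hvar _ (by linarith [hδ j]) (by linarith [hδ0 j]))
    (fun p hp => hp.1) ?_
  refine ⟨(a * (p₀ + 4 * c * ε - p₀) / (1 / r ^ 2)) • e,
    (a * (p₀ - 4 * c * ε - p₀) / (1 / r ^ 2)) • e, fun x => ?_⟩
  rw [quadLoss_mean hne', quadLoss_mean hne', quadLoss_mean hne', quadratic_eq hw.ne' _ he,
    quadratic_eq hw.ne' _ he, sub_self, sub_self, norm_zero]
  have h1 : 0 ≤ 1 / r ^ 2 / 2 * ‖x‖ ^ 2 := by positivity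
  have h2 : ∀ m : ℝ, m ^ 2 / (2 * (1 / r ^ 2)) = (m * r) ^ 2 / 2 := fun m => by
    field_simp
  rw [h2, h2, add_sub_cancel_left, sub_sub_cancel_left, hsep,
    show (a * -(4 * c * ε) * r) ^ 2 = (a * (4 * c * ε) * r) ^ 2 by ring, hsep]
  simp only [sub_self, mul_zero, zero_mul, sub_zero]
  linarith

theorem smoothClass_lower_bound {H : Set (Ξ → Vec d)} {o : Oracle} {b : Fin N → Fin N → ℝ}
    {ε r σ : ℝ} {i : Fin N} (hd : 0 < d) (hΞ : ∃ ξ ∈ Ξ, ∃ ξ' ∈ Ξ, ξ ≠ ξ' ∧ dist ξ ξ' ≤ 1)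
    (hH : H ⊆ locBounded Ξ d) (hb : IsPseudoDist b) (hr : 0 < r) (hσ : 0 < σ)
    (hrσ : 2 ≤ r ^ 2 * σ ^ 2) (hε : 0 < ε) (hε' : ε < 1 / 16) :
    ENNReal.ofReal (1 / 144 * r ^ 2 * σ ^ 2 * N /
      (ε * numClose (fun j k => b j k / 4) ε i)) ≤
      minimaxComplexity o (smoothClass N d Ξ H (1 / r ^ 2) (1 / r ^ 2) r b σ) i ε := by
  have hs : 0 < √ε := Real.sqrt_pos.2 hε
  have hss : √ε ^ 2 = ε := Real.sq_sqrt hε.le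
  have key : ENNReal.ofReal (N / (9 * (numClose (fun j k => b j k / 4) ε i *
      (16 * ε / (r ^ 2 * σ ^ 2))))) ≤
      minimaxComplexity o (smoothClass N d Ξ H (1 / r ^ 2) (1 / r ^ 2) r b σ) i ε := by
    rcases le_total (2 * (r ^ 2 * σ ^ 2) * ε) (1 / 2) with h | h
    · refine smoothClass_lower_bound_aux (c := 1) (p₀ := 2 * (r ^ 2 * σ ^ 2) * ε)
        (a := 1 / (2 * r * √ε)) hd hΞ hH hb hr hε hε' zero_le_one le_rfl (by positivity) h
        (by nlinarith) (by positivity) ?_ (fun P h0 hP => ?_) (by positivity) (le_of_eq ?_)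
      · field_simp
        rw [hss]
        ring
      · calc (1 / (2 * r * √ε)) ^ 2 * (P * (1 - P))
            ≤ (1 / (2 * r * √ε)) ^ 2 * (2 * (2 * (r ^ 2 * σ ^ 2) * ε)) := by
              refine mul_le_mul_of_nonneg_left (le_trans ?_ hP) (sq_nonneg _)
              nlinarith
          _ = σ ^ 2 := by rw [div_pow, mul_pow, hss]; field_simp
      · field_simp; norm_num
    · have hsrσ : 1 ≤ 2 * (r * σ * √ε) := by
        have : 1 ≤ (2 * (r * σ * √ε)) ^ 2 := by
          rw [show (2 * (r * σ * √ε)) ^ 2 = 4 * (r ^ 2 * σ ^ 2) * √ε ^ 2 by ring, hss]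
          linarith
        exact (one_le_sq_iff₀ (by positivity)).1 this
      have hc : 1 / (4 * (r * σ * √ε)) ≤ 1 := by
        rw [div_le_one (by positivity)]; linarith
      refine smoothClass_lower_bound_aux (c := 1 / (4 * (r * σ * √ε))) (p₀ := 1 / 2)
        (a := 2 * σ) hd hΞ hH hb hr hε hε' (by positivity) hc (by norm_num) le_rfl
        (by nlinarith) (by positivity) ?_ (fun P h0 hP => ?_) (by positivity) ?_
      · field_simp
        rw [hss]
        ring
      · nlinarith [mul_nonneg (sq_nonneg σ) (sq_nonneg (2 * P - 1))]
      · rw [show 32 * (1 / (4 * (r * σ * √ε))) ^ 2 * ε ^ 2 / (1 / 2)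
            = 4 * ε ^ 2 / (r ^ 2 * σ ^ 2 * √ε ^ 2) by field_simp; norm_num, hss,
          div_le_div_iff₀ (by positivity) (by positivity)]
        have : 0 ≤ ε ^ 2 * (r ^ 2 * σ ^ 2) := by positivity
        nlinarith
  refine le_trans (le_of_eq ?_) key
  congr 1
  rcases ne_or_eq (numClose (fun j k => b j k / 4) ε i : ℝ) 0 with h | h
  · field_simp; ring
  · simp [h]

end Quadratic

end CollabGEM

theorem mainTheorem7 :
    (∃ C : ℝ, 0 < C ∧
      ∀ (N d D : ℕ) (Ξ : Set (CollabGEM.Vec D)) (H : Set (Ξ → CollabGEM.Vec d))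
        (o : CollabGEM.Oracle) (b : Fin N → Fin N → ℝ) (r B ε : ℝ) (i : Fin N),
        0 < d → (∃ ξ ∈ Ξ, ∃ ξ' ∈ Ξ, ξ ≠ ξ' ∧ dist ξ ξ' ≤ 1) →
        H ⊆ CollabGEM.locBounded Ξ d → CollabGEM.IsPseudoDist b →
        0 < r → 0 < B → 1 ≤ r ^ 2 * B ^ 2 → 0 < ε → ε < 1 / 16 →
        ENNReal.ofReal (C * B ^ 2 * r ^ 2 * N /
            (ε ^ 2 * CollabGEM.numClose (fun j k => b j k / 4) ε i)) ≤
          CollabGEM.minimaxComplexity o (CollabGEM.convexClass N d Ξ H r b B) i ε) ∧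
    (∃ C' : ℝ, 0 < C' ∧
      ∀ (N d D : ℕ) (Ξ : Set (CollabGEM.Vec D)) (H : Set (Ξ → CollabGEM.Vec d))
        (o : CollabGEM.Oracle) (b : Fin N → Fin N → ℝ) (r σ ε : ℝ) (i : Fin N),
        0 < d → (∃ ξ ∈ Ξ, ∃ ξ' ∈ Ξ, ξ ≠ ξ' ∧ dist ξ ξ' ≤ 1) →
        H ⊆ CollabGEM.locBounded Ξ d → CollabGEM.IsPseudoDist b →
        0 < r → 0 < σ → 2 ≤ r ^ 2 * σ ^ 2 → 0 < ε → ε < 1 / 16 →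
        ENNReal.ofReal (C' * r ^ 2 * σ ^ 2 * N /
            (ε * CollabGEM.numClose (fun j k => b j k / 4) ε i)) ≤
          CollabGEM.minimaxComplexity o
            (CollabGEM.smoothClass N d Ξ H (1 / r ^ 2) (1 / r ^ 2) r b σ) i ε) := by
  refine ⟨⟨1 / 36, by norm_num, ?_⟩, ⟨1 / 144, by norm_num, ?_⟩⟩
  · intro N d D Ξ H o b r B ε i hd hΞ hH hb hr hB hrB hε hε'
    exact CollabGEM.convexClass_lower_bound hd hΞ hH hb hr hB hrB hε hε'
  · intro N d D Ξ H o b r σ ε i hd hΞ hH hb hr hσ hrσ hε hε'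
    exact CollabGEM.smoothClass_lower_bound hd hΞ hH hb hr hσ hrσ hε hε'
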